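/- Let $\hat\rho,\hat\sigma$ be density matrices (positive semidefinite, trace one) on a finite-dimensional complex Hilbert space with the same eigenvalues, counted with multiplicity, and let $\|\cdot\|$ be the operator norm. A charging Hamiltonian on $[0,T]$ is a measurable family $(\hat V_t)_{t\in[0,T]}$ of Hermitian matrices with $\|\hat V_t\|=1$ for all $t$; it generates the unitary $U=\mathrm{Texp}\left(-i\int_0^T\hat V_t\,dt\right)=\Phi_T$, where $\Phi$ is the continuous solution of $\Phi_t=1-i\int_0^t\hat V_s\Phi_s\,ds$ on $[0,T]$, and it evolves $\hat\rho$ into $\hat\sigma$ in time $T\ge 0$ if $U\hat\rho U^\dagger=\hat\sigma$. The charging distance $D(\hat\rho,\hat\sigma)$ is the infimum of the times $T\ge0$ in which some charging Hamiltonian evolves $\hat\rho$ into $\hat\sigma$. For a unitary $U$ let $\ln U$ be its principal logarithm (principal branch, imaginary part in $(-\pi,\pi]$, applied to the eigenvalues). Then the infimum is attained, and it is attained by some time-independent charging Hamiltonian. Moreover \[ D(\hat\rho,\hat\sigma)=\min_{U:\,U\hat\rho U^\dagger=\hat\sigma}\|i\ln U\|, \] where the minimum runs over all unitaries $U$ with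 $U\hat\rho U^\dagger=\hat\sigma$ and is attained. Every unitary $U_{\mathrm{opt}}$ attaining this minimum is generated in time $D(\hat\rho,\hat\sigma)$ by a time-independent charging Hamiltonian, which therefore evolves $\hat\rho$ into $\hat\sigma$ in the shortest possible time. If $\hat\rho\ne\hat\sigma$, then $D(\hat\rho,\hat\sigma)>0$ and one may take this Hamiltonian to be $\hat V_{\mathrm{opt}}=i\ln(U_{\mathrm{opt}})/D(\hat\rho,\hat\sigma)$. -/

import Mathlib

open scoped ComplexOrder Matrix Matrix.Norms.L2Operator

namespace QuantumCharging

variable {n : Type*} [Fintype n] [DecidableEq n]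

/-- Density matrices: positive semidefinite with unit trace. -/
def IsDensityMatrix (ρ : Matrix n n ℂ) : Prop :=
  ρ.PosSemidef ∧ ρ.trace = 1

/-- The eigenvalues of `ρ` and `σ` agree, counted with multiplicity. -/
def SameSpectrum (ρ σ : Matrix n n ℂ) : Prop :=
  ρ.charpoly.roots = σ.charpoly.roots

/-- A (possibly time-dependent) charging Hamiltonian on `[0, T]`: measurable in time, Hermitian,
and of operator norm one at every time. -/
structure IsChargingHamiltonian (T : ℝ) (V : ℝ → Matrix n n ℂ) : Prop where
  measurable : MeasureTheory.AEStronglyMeasurable V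
    (MeasureTheory.volume.restrict (Set.Icc 0 T))
  hermitian : ∀ t ∈ Set.Icc 0 T, (V t).IsHermitian
  norm_eq_one : ∀ t ∈ Set.Icc 0 T, ‖V t‖ = 1

/-- `U` is the time-ordered exponential `Texp (-i ∫₀ᵀ V_t dt)`: the value at time `T` of the
continuous solution of `Φ t = 1 - i ∫₀ᵗ V_s Φ_s ds`, the integrated form of
`Φ' = -i V Φ`, `Φ 0 = 1`. -/
def IsTimeOrderedExp (V : ℝ → Matrix n n ℂ) (T : ℝ) (U : Matrix n n ℂ) : Prop :=
  ∃ Φ : ℝ → Matrix n n ℂ,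
    ContinuousOn Φ (Set.Icc 0 T) ∧
    (∀ t ∈ Set.Icc 0 T, Φ t = 1 - Complex.I • ∫ s in (0 : ℝ)..t, V s * Φ s) ∧
    Φ T = U

/-- The charging Hamiltonian `V` evolves `ρ` into `σ` in time `T`. -/
def Charges (ρ σ : Matrix n n ℂ) (V : ℝ → Matrix n n ℂ) (T : ℝ) : Prop :=
  0 ≤ T ∧ IsChargingHamiltonian T V ∧
    ∃ U : Matrix n n ℂ, IsTimeOrderedExp V T U ∧ U * ρ * Uᴴ = σ

/-- All times in which some charging Hamiltonian evolves `ρ` into `σ`. -/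
def chargingTimes (ρ σ : Matrix n n ℂ) : Set ℝ :=
  {T | ∃ V : ℝ → Matrix n n ℂ, Charges ρ σ V T}

/-- The quantum charging distance. -/
noncomputable def chargingDistance (ρ σ : Matrix n n ℂ) : ℝ :=
  sInf (chargingTimes ρ σ)

/-- The unitaries that transform `ρ` into `σ`. -/
def connectingUnitaries (ρ σ : Matrix n n ℂ) : Set (Matrix n n ℂ) :=
  {U | U ∈ Matrix.unitaryGroup n ℂ ∧ U * ρ * Uᴴ = σ}

/-- The principal logarithm of a normal matrix: the principal branch of the complex logarithm
(imaginary part in `(-π, π]`) applied to its eigenvalues. The spectrum is finite, so every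
function is continuous on it and the functional calculus always applies. -/
noncomputable def matrixLog (U : Matrix n n ℂ) : Matrix n n ℂ :=
  cfc Complex.log U

/-- `U` attains the minimum of `‖i ln U‖` over the unitaries that transform `ρ` into `σ`. -/
def IsOptimalUnitary (ρ σ U : Matrix n n ℂ) : Prop :=
  U ∈ connectingUnitaries ρ σ ∧
    ∀ W ∈ connectingUnitaries ρ σ, ‖Complex.I • matrixLog U‖ ≤ ‖Complex.I • matrixLog W‖

end QuantumCharging

/-! The lower bound is geometric. On unit vectors the angle is `2 arcsin (‖x - y‖ / 2)`, so its
triangle inequality passes to the same function of operator-norm distances between unitaries. A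
Hamiltonian of norm at most one makes the propagator `Φ` `1`-Lipschitz, so subdividing `[0, T]` ever
more finely shows that `Φ T` lies within arc distance `T` of `Φ 0 = 1`. On the other hand the arc
distance from a unitary `U` to `1` is exactly `‖i ln U‖`. Conversely, for `U ≠ 1` the constant
Hamiltonian `i ln U / ‖i ln U‖` generates `U` in time `‖i ln U‖`. Being an arc distance, `‖i ln U‖`
is continuous in `U`, although `ln U` is not, so it attains its minimum on the compact set of
unitaries carrying `ρ` to `σ`. -/

namespace QuantumCharging

open Complex (I)
open Filter InnerProductGeometry MeasureTheory Set Topology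

lemma sub_le_mul_sub_of_hasDerivWithinAt {f g : ℝ → ℝ} {a b c : ℝ} (hab : a ≤ b)
    (hg : HasDerivWithinAt g c (Ici 0) 0) (hg₀ : g 0 = 0)
    (hfg : ∀ s ∈ Icc a b, ∀ t ∈ Icc a b, s ≤ t → f t - f s ≤ g (t - s)) :
    f b - f a ≤ c * (b - a) := by
  have hba : 0 ≤ b - a := sub_nonneg.2 hab
  have hlim : Tendsto (fun N : ℕ => (N : ℝ) * g ((b - a) / N)) atTop (𝓝 (c * (b - a))) := by
    have hscale : HasDerivWithinAt (fun u : ℝ => (b - a) * u) (b - a) (Ioi 0) 0 := by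
      simpa using ((hasDerivAt_id (0 : ℝ)).const_mul (b - a)).hasDerivWithinAt
    have hcomp : HasDerivWithinAt (fun u => g ((b - a) * u)) (c * (b - a)) (Ioi 0) 0 :=
      hg.comp_of_eq 0 hscale (fun u hu => mul_nonneg hba (le_of_lt hu)) (mul_zero _).symm
    have hinv : Tendsto (fun N : ℕ => (N : ℝ)⁻¹) atTop (𝓝[>] 0) :=
      tendsto_inv_atTop_nhdsGT_zero.comp tendsto_natCast_atTop_atTop
    have hslope := ((hasDerivWithinAt_iff_tendsto_slope' self_notMem_Ioi).1 hcomp).comp hinv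
    refine hslope.congr fun N => ?_
    simp [slope_def_field, hg₀, div_eq_mul_inv, mul_comm]
  refine ge_of_tendsto hlim ?_
  filter_upwards [eventually_gt_atTop 0] with N hN
  set x : ℕ → ℝ := fun k => a + k * ((b - a) / N) with hx
  have hxN : x N = b := by
    simp only [hx]
    field_simp
    ring
  have hmono : Monotone x := fun i j hij => by
    simp only [hx]
    gcongr
  have hmem (k : ℕ) (hk : k ≤ N) : x k ∈ Icc a b :=
    ⟨by simpa [hx] using hmono (Nat.zero_le k), hxN ▸ hmono hk⟩
  calc f b - f a = ∑ k ∈ Finset.range N, (f (x (k + 1)) - f (x k)) := by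
        rw [Finset.sum_range_sub (fun k => f (x k)), hxN]
        simp [hx]
    _ ≤ ∑ k ∈ Finset.range N, g (x (k + 1) - x k) := Finset.sum_le_sum fun k hk =>
        have hk' := Finset.mem_range.1 hk
        hfg _ (hmem k hk'.le) _ (hmem (k + 1) hk') (hmono k.le_succ)
    _ = N * g ((b - a) / N) := by
        have hstep (k : ℕ) : x (k + 1) - x k = (b - a) / N := by
          simp only [hx, Nat.cast_succ]
          ring
        simp [hstep]

section ArcDist

/-- The length of the arc of the unit circle cut off by a chord of length `‖x - y‖`. For chords
longer than `2`, which do not occur between unitaries, `Real.arcsin` truncates the value to `π`. -/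
noncomputable def arcDist {E : Type*} [SeminormedAddCommGroup E] (x y : E) : ℝ :=
  2 * Real.arcsin (‖x - y‖ / 2)

lemma arcDist_self {E : Type*} [SeminormedAddCommGroup E] (x : E) : arcDist x x = 0 := by
  simp [arcDist]

lemma arcDist_le_two_mul_arcsin {E : Type*} [SeminormedAddCommGroup E] {x y : E} {r : ℝ}
    (h : ‖x - y‖ ≤ r) : arcDist x y ≤ 2 * Real.arcsin (r / 2) := by
  unfold arcDist
  gcongr

lemma arcDist_nonneg {E : Type*} [SeminormedAddCommGroup E] (x y : E) : 0 ≤ arcDist x y :=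
  mul_nonneg zero_le_two (Real.arcsin_nonneg.2 (by positivity))

lemma arcDist_le_pi {E : Type*} [SeminormedAddCommGroup E] (x y : E) : arcDist x y ≤ Real.pi := by
  unfold arcDist
  linarith [Real.arcsin_le_pi_div_two (‖x - y‖ / 2)]

lemma arcDist_le_iff_norm_sub_le {E : Type*} [SeminormedAddCommGroup E] {x y : E} {θ : ℝ}
    (h₀ : 0 ≤ θ) (hπ : θ < Real.pi) : arcDist x y ≤ θ ↔ ‖x - y‖ ≤ 2 * Real.sin (θ / 2) := by
  rw [arcDist, ← le_div_iff₀' two_pos, Real.arcsin_le_iff_le_sin' ⟨by linarith, by linarith⟩,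
    div_le_iff₀' two_pos]

lemma arcDist_eq_of_norm_sub_sq {E : Type*} [SeminormedAddCommGroup E] {x y : E} {θ : ℝ}
    (h₀ : 0 ≤ θ) (hπ : θ ≤ Real.pi) (h : ‖x - y‖ ^ 2 = 2 * (1 - Real.cos θ)) :
    arcDist x y = θ := by
  have hsin : 0 ≤ Real.sin (θ / 2) := Real.sin_nonneg_of_nonneg_of_le_pi (by linarith) (by linarith)
  have hchord : ‖x - y‖ = 2 * Real.sin (θ / 2) := by
    refine (sq_eq_sq₀ (norm_nonneg _) (by positivity)).1 ?_
    rw [h, mul_pow, Real.sin_sq_eq_half_sub, mul_div_cancel₀ _ two_ne_zero]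
    ring
  rw [arcDist, hchord, mul_div_cancel_left₀ _ two_ne_zero, Real.arcsin_sin (by linarith)
    (by linarith), mul_div_cancel₀ _ two_ne_zero]

lemma arcDist_eq_angle {F : Type*} [NormedAddCommGroup F] [InnerProductSpace ℝ F] {x y : F}
    (hx : ‖x‖ = 1) (hy : ‖y‖ = 1) : arcDist x y = angle x y := by
  refine arcDist_eq_of_norm_sub_sq (angle_nonneg x y) (angle_le_pi x y) ?_
  rw [norm_sub_sq_real, ← cos_angle_mul_norm_mul_norm, hx, hy]
  ring

lemma arcDist_triangle_of_norm_eq_one {F : Type*} [NormedAddCommGroup F] [InnerProductSpace ℝ F]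
    {x y z : F} (hx : ‖x‖ = 1) (hy : ‖y‖ = 1) (hz : ‖z‖ = 1) :
    arcDist x z ≤ arcDist x y + arcDist y z := by
  rw [arcDist_eq_angle hx hz, arcDist_eq_angle hx hy, arcDist_eq_angle hy hz]
  exact angle_le_angle_add_angle x y z

lemma arcDist_triangle_of_norm_map {𝕜 E F : Type*} [RCLike 𝕜] [NormedAddCommGroup E]
    [NormedSpace 𝕜 E] [NormedAddCommGroup F] [InnerProductSpace 𝕜 F] {f g h : E →L[𝕜] F}
    (hf : ∀ x, ‖f x‖ = ‖x‖) (hg : ∀ x, ‖g x‖ = ‖x‖) (hh : ∀ x, ‖h x‖ = ‖x‖) :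
    arcDist f h ≤ arcDist f g + arcDist g h := by
  let _ : InnerProductSpace ℝ F := .rclikeToReal 𝕜 F
  set θ := arcDist f g + arcDist g h
  have hθ : 0 ≤ θ := add_nonneg (arcDist_nonneg f g) (arcDist_nonneg g h)
  rcases le_or_gt Real.pi θ with hπ | hπ
  · exact (arcDist_le_pi f h).trans hπ
  have hpoint (x : E) (hx : ‖x‖ = 1) : arcDist (f x) (h x) ≤ θ := by
    have hle (u v : E →L[𝕜] F) : arcDist (u x) (v x) ≤ arcDist u v :=
      arcDist_le_two_mul_arcsin (by simpa [hx] using (u - v).le_opNorm x)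
    calc arcDist (f x) (h x) ≤ arcDist (f x) (g x) + arcDist (g x) (h x) :=
          arcDist_triangle_of_norm_eq_one ((hf x).trans hx) ((hg x).trans hx) ((hh x).trans hx)
      _ ≤ θ := add_le_add (hle f g) (hle g h)
  have hsin : 0 ≤ Real.sin (θ / 2) :=
    Real.sin_nonneg_of_nonneg_of_le_pi (by linarith) (by linarith)
  refine (arcDist_le_iff_norm_sub_le hθ hπ).2 ?_
  exact ContinuousLinearMap.opNorm_le_of_unit_norm (by positivity) fun x hx =>
    (arcDist_le_iff_norm_sub_le hθ hπ).1 (hpoint x hx)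

variable {n : Type*} [Fintype n] [DecidableEq n]

lemma arcDist_triangle_of_mem_unitaryGroup {U V W : Matrix n n ℂ}
    (hU : U ∈ Matrix.unitaryGroup n ℂ) (hV : V ∈ Matrix.unitaryGroup n ℂ)
    (hW : W ∈ Matrix.unitaryGroup n ℂ) : arcDist U W ≤ arcDist U V + arcDist V W := by
  have hmap {X : Matrix n n ℂ} (hX : X ∈ Matrix.unitaryGroup n ℂ) :
      ∀ x, ‖Matrix.toEuclideanCLM (n := n) (𝕜 := ℂ) X x‖ = ‖x‖ :=
    ContinuousLinearMap.norm_map_of_mem_unitary (Unitary.map_mem _ hX)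
  have harc (X Y : Matrix n n ℂ) : arcDist X Y = arcDist
      (Matrix.toEuclideanCLM (n := n) (𝕜 := ℂ) X) (Matrix.toEuclideanCLM (n := n) (𝕜 := ℂ) Y) := by
    rw [arcDist, arcDist, ← map_sub, Matrix.l2_opNorm_toEuclideanCLM]
  simpa only [harc] using arcDist_triangle_of_norm_map (hmap hU) (hmap hV) (hmap hW)

lemma arcDist_le_mul_of_norm_sub_le {γ : ℝ → Matrix n n ℂ} {a b K : ℝ} (hab : a ≤ b)
    (hγ : ∀ t ∈ Icc a b, γ t ∈ Matrix.unitaryGroup n ℂ)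
    (hK : ∀ s ∈ Icc a b, ∀ t ∈ Icc a b, s ≤ t → ‖γ t - γ s‖ ≤ K * (t - s)) :
    arcDist (γ b) (γ a) ≤ K * (b - a) := by
  have hderiv : HasDerivAt (fun h : ℝ => 2 * Real.arcsin (K * h / 2)) K 0 := by
    have hlin : HasDerivAt (fun h : ℝ => K * h / 2) (K / 2) 0 := by
      simpa using ((hasDerivAt_id (0 : ℝ)).const_mul K).div_const 2
    have harcsin : HasDerivAt Real.arcsin 1 0 := by
      simpa using Real.hasDerivAt_arcsin (x := 0) (by norm_num) (by norm_num)
    simpa [mul_div_cancel₀] using (harcsin.comp_of_eq 0 hlin (by simp)).const_mul 2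
  have ha := left_mem_Icc.2 hab
  have h := sub_le_mul_sub_of_hasDerivWithinAt (f := fun t => arcDist (γ t) (γ a)) hab
    hderiv.hasDerivWithinAt (by simp) fun s hs t ht hst => ?_
  · simpa [arcDist_self] using h
  · linarith [arcDist_triangle_of_mem_unitaryGroup (hγ t ht) (hγ s hs) (hγ a ha),
      arcDist_le_two_mul_arcsin (hK s hs t ht hst)]

end ArcDist

section MatrixLog

lemma arcDist_expUnitary_one {A : Type*} [CStarAlgebra A] {x : selfAdjoint A}
    (hx : ‖x‖ ≤ Real.pi) : arcDist (selfAdjoint.expUnitary x : A) 1 = ‖x‖ :=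
  arcDist_eq_of_norm_sub_sq (norm_nonneg x) hx (selfAdjoint.norm_sq_expUnitary_sub_one hx)

variable {n : Type*} [Fintype n] [DecidableEq n] {U : Matrix n n ℂ}

lemma exp_matrixLog (hU : IsStarNormal U) (hU' : IsUnit U) :
    NormedSpace.exp (matrixLog U) = U := by
  have hspec := U.finite_spectrum
  rw [matrixLog, ← CFC.complex_exp_eq_normedSpace_exp (cfc_predicate _ _),
    ← cfc_comp' _ _ U ((hspec.image _).continuousOn _) (hspec.continuousOn _)]
  refine (cfc_congr fun z hz => Complex.exp_log ?_).trans (cfc_id' ℂ U)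
  exact spectrum.ne_zero_of_mem_of_unit (a := hU'.unit) hz

lemma log_eq_arg_mul_I {z : ℂ} (hz : ‖z‖ = 1) : Complex.log z = z.arg * I := by
  simp [Complex.log, hz]

lemma isHermitian_I_smul_matrixLog (hU : U ∈ Matrix.unitaryGroup n ℂ) :
    (I • matrixLog U).IsHermitian := by
  have hlog : matrixLog U = cfc (fun z => z.arg * I : ℂ → ℂ) U :=
    cfc_congr fun z hz => log_eq_arg_mul_I (by simpa using spectrum.subset_circle_of_unitary hU hz)
  rw [hlog, ← cfc_smul I _ U (U.finite_spectrum.continuousOn _)]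
  change IsSelfAdjoint _
  rw [isSelfAdjoint_iff, ← cfc_star]
  simp

lemma norm_I_smul_matrixLog_le_pi (hU : U ∈ Matrix.unitaryGroup n ℂ) :
    ‖I • matrixLog U‖ ≤ Real.pi := by
  rw [norm_smul, Complex.norm_I, one_mul]
  refine norm_cfc_le Real.pi_pos.le fun z hz => ?_
  rw [log_eq_arg_mul_I (by simpa using spectrum.subset_circle_of_unitary hU hz)]
  simpa using Complex.abs_arg_le_pi z

lemma norm_I_smul_matrixLog (hU : U ∈ Matrix.unitaryGroup n ℂ) :
    ‖I • matrixLog U‖ = arcDist U 1 := by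
  set x : selfAdjoint (Matrix n n ℂ) := -⟨I • matrixLog U, isHermitian_I_smul_matrixLog hU⟩
  have hx : ‖x‖ = ‖I • matrixLog U‖ := norm_neg _
  have hexp : (selfAdjoint.expUnitary x : Matrix n n ℂ) = U := by
    have hIx : I • (x : Matrix n n ℂ) = matrixLog U := by simp [x, smul_smul]
    rw [selfAdjoint.expUnitary_coe, hIx, exp_matrixLog (Unitary.coe_isStarNormal ⟨U, hU⟩)
      (Unitary.isUnit_coe (U := ⟨U, hU⟩))]
  rw [← hx, ← arcDist_expUnitary_one (hx.trans_le (norm_I_smul_matrixLog_le_pi hU)), hexp]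

end MatrixLog

section Propagator

/-- `Φ` is the propagator on `[0, T]` of the generator `-i V`, that is, a continuous solution there
of the integral equation in `IsTimeOrderedExp`, for coefficients in any complex normed algebra. -/
def IsPropagator {A : Type*} [NormedRing A] [NormedAlgebra ℂ A] (V : ℝ → A) (T : ℝ) (Φ : ℝ → A) :
    Prop :=
  ContinuousOn Φ (Icc 0 T) ∧ ∀ t ∈ Icc 0 T, Φ t = 1 - I • ∫ s in (0 : ℝ)..t, V s * Φ s

lemma isPropagator_exp {A : Type*} [NormedRing A] [NormedAlgebra ℂ A] [CompleteSpace A] (V : A)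
    (T : ℝ) : IsPropagator (fun _ => V) T fun t => NormedSpace.exp ((t : ℂ) • (-I • V)) := by
  set B := -I • V with hB
  set Φ : ℝ → A := fun t => NormedSpace.exp ((t : ℂ) • B)
  have hderiv (t : ℝ) : HasDerivAt Φ (B * Φ t) t := by
    have h := (hasDerivAt_exp_smul_const' (𝕂 := ℂ) B (t : ℂ)).scomp t
      Complex.ofRealCLM.hasDerivAt
    rwa [Complex.ofRealCLM_apply, Complex.ofReal_one, one_smul] at h
  have hcont : Continuous Φ := continuous_iff_continuousAt.2 fun t => (hderiv t).continuousAt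
  refine ⟨hcont.continuousOn, fun t _ => ?_⟩
  have hftc : ∫ s in (0 : ℝ)..t, B * Φ s = Φ t - Φ 0 :=
    intervalIntegral.integral_eq_sub_of_hasDerivAt (fun s _ => hderiv s)
      ((continuous_const.mul hcont).intervalIntegrable _ _)
  have hI : I • ∫ s in (0 : ℝ)..t, V * Φ s = -∫ s in (0 : ℝ)..t, B * Φ s := by
    rw [← intervalIntegral.integral_smul, ← intervalIntegral.integral_neg]
    simp [hB]
  rw [hI, hftc]
  simp [Φ]

namespace IsPropagator

variable {A : Type*} {V Φ : ℝ → A} {T K M : ℝ}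

section NormedAlgebra

variable [NormedRing A] [NormedAlgebra ℂ A]

lemma apply_zero (hΦ : IsPropagator V T Φ) (hT : 0 ≤ T) : Φ 0 = 1 := by
  simpa using hΦ.2 0 (left_mem_Icc.2 hT)

lemma intervalIntegrable_mul (hΦ : IsPropagator V T Φ)
    (hV : AEStronglyMeasurable V (volume.restrict (Icc 0 T))) (hK : ∀ t ∈ Icc 0 T, ‖V t‖ ≤ K)
    {s t : ℝ} (hs : s ∈ Icc 0 T) (ht : t ∈ Icc 0 T) :
    IntervalIntegrable (fun r => V r * Φ r) volume s t := by
  have hVint : IntegrableOn V (Icc 0 T) :=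
    Integrable.of_bound hV K ((ae_restrict_iff' measurableSet_Icc).2 (.of_forall hK))
  exact ((hVint.mul_continuousOn hΦ.1 isCompact_Icc).mono_set
    (uIcc_subset_Icc hs ht)).intervalIntegrable

lemma norm_sub_le (hΦ : IsPropagator V T Φ)
    (hV : AEStronglyMeasurable V (volume.restrict (Icc 0 T))) (hK : ∀ t ∈ Icc 0 T, ‖V t‖ ≤ K)
    (hM : ∀ t ∈ Icc 0 T, ‖Φ t‖ ≤ M) {s t : ℝ} (hs : s ∈ Icc 0 T) (ht : t ∈ Icc 0 T) :
    ‖Φ t - Φ s‖ ≤ K * M * |t - s| := by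
  have h₀ : (0 : ℝ) ∈ Icc 0 T := left_mem_Icc.2 (hs.1.trans hs.2)
  have hsub : Φ t - Φ s = -(I • ∫ r in s..t, V r * Φ r) := by
    rw [hΦ.2 t ht, hΦ.2 s hs, sub_sub_sub_cancel_left, ← neg_sub, ← smul_sub,
      intervalIntegral.integral_interval_sub_left (hΦ.intervalIntegrable_mul hV hK h₀ ht)
        (hΦ.intervalIntegrable_mul hV hK h₀ hs)]
  rw [hsub, norm_neg, norm_smul, Complex.norm_I, one_mul]
  refine intervalIntegral.norm_integral_le_of_norm_le_const fun r hr => ?_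
  have hr' : r ∈ Icc 0 T := uIcc_subset_Icc hs ht (uIoc_subset_uIcc hr)
  exact norm_mul_le_of_le (hK r hr') (hM r hr')

lemma ae_hasDerivAt [CompleteSpace A] (hΦ : IsPropagator V T Φ)
    (hV : AEStronglyMeasurable V (volume.restrict (Icc 0 T))) (hK : ∀ t ∈ Icc 0 T, ‖V t‖ ≤ K) :
    ∀ᵐ t, t ∈ Icc 0 T → HasDerivAt Φ (-(I • (V t * Φ t))) t := by
  rcases lt_or_ge T 0 with hT | hT
  · simp [Icc_eq_empty_of_lt hT]
  have hint := hΦ.intervalIntegrable_mul hV hK (left_mem_Icc.2 hT) (right_mem_Icc.2 hT)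
  filter_upwards [hint.ae_hasDerivAt_integral, Measure.ae_ne volume 0, Measure.ae_ne volume T]
    with t hderiv ht₀ htT ht
  have hnhds : Icc 0 T ∈ 𝓝 t := Icc_mem_nhds (ht.1.lt_of_ne' ht₀) (ht.2.lt_of_ne htT)
  have hsol := ((hderiv (by rwa [uIcc_of_le hT]) 0 left_mem_uIcc).const_smul I).const_sub 1
  exact hsol.congr_of_eventuallyEq (eventually_of_mem hnhds hΦ.2)

end NormedAlgebra

variable [CStarAlgebra A]

lemma star_mul_self_eq_one (hΦ : IsPropagator V T Φ)
    (hV : AEStronglyMeasurable V (volume.restrict (Icc 0 T))) (hK : ∀ t ∈ Icc 0 T, ‖V t‖ ≤ K)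
    (hsa : ∀ t ∈ Icc 0 T, IsSelfAdjoint (V t)) {t : ℝ} (ht : t ∈ Icc 0 T) :
    star (Φ t) * Φ t = 1 := by
  have hT : 0 ≤ T := ht.1.trans ht.2
  have hac : AbsolutelyContinuousOnInterval (fun t => star (Φ t) * Φ t) 0 T := by
    obtain ⟨M, hM⟩ := isCompact_Icc.exists_bound_of_continuousOn hΦ.1
    refine LipschitzOnWith.absolutelyContinuousOnInterval
      (K := (M * (K * M) + K * M * M).toNNReal) ?_
    rw [uIcc_of_le hT]
    refine LipschitzOnWith.of_dist_le' fun t ht s hs => ?_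
    have hsub := hΦ.norm_sub_le hV hK hM hs ht
    rw [dist_eq_norm, Real.dist_eq]
    calc ‖star (Φ t) * Φ t - star (Φ s) * Φ s‖
        = ‖star (Φ t) * (Φ t - Φ s) + star (Φ t - Φ s) * Φ s‖ := by
          rw [star_sub, mul_sub, sub_mul, sub_add_sub_cancel]
      _ ≤ M * (K * M * |t - s|) + K * M * |t - s| * M :=
          norm_add_le_of_le (norm_mul_le_of_le ((norm_star _).trans_le (hM t ht)) hsub)
            (norm_mul_le_of_le ((norm_star _).trans_le hsub) (hM s hs))
      _ = (M * (K * M) + K * M * M) * |t - s| := by ring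
  have hderiv : ∀ᵐ t, t ∈ uIcc 0 T → HasDerivAt (fun t => star (Φ t) * Φ t) 0 t := by
    rw [uIcc_of_le hT]
    filter_upwards [hΦ.ae_hasDerivAt hV hK] with t hΦ' ht
    refine ((hΦ' ht).star.fun_mul (hΦ' ht)).congr_deriv ?_
    simp [(hsa t ht).star_eq, mul_assoc]
  obtain ⟨C, hC⟩ := hac.const_of_ae_hasDerivAt_zero hderiv
  rw [hC t (by rwa [uIcc_of_le hT]), ← hC 0 left_mem_uIcc, hΦ.apply_zero hT, star_one, one_mul]

end IsPropagator

end Propagator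

section Charging

lemma norm_le_one_of_mem_unitary {A : Type*} [NormedRing A] [StarRing A] [CStarRing A] {u : A}
    (hu : u ∈ unitary A) : ‖u‖ ≤ 1 := by
  nontriviality A
  exact (CStarRing.norm_of_mem_unitary hu).le

variable {n : Type*} [Fintype n] [DecidableEq n] {ρ σ U : Matrix n n ℂ}

lemma isTimeOrderedExp_iff_exists_isPropagator {V : ℝ → Matrix n n ℂ} {T : ℝ} :
    IsTimeOrderedExp V T U ↔ ∃ Φ, IsPropagator V T Φ ∧ Φ T = U := by
  simp only [IsTimeOrderedExp, IsPropagator, and_assoc]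

lemma IsPropagator.mem_unitaryGroup {V Φ : ℝ → Matrix n n ℂ} {T K : ℝ} (hΦ : IsPropagator V T Φ)
    (hV : AEStronglyMeasurable V (volume.restrict (Icc 0 T))) (hK : ∀ t ∈ Icc 0 T, ‖V t‖ ≤ K)
    (hherm : ∀ t ∈ Icc 0 T, (V t).IsHermitian) {t : ℝ} (ht : t ∈ Icc 0 T) :
    Φ t ∈ Matrix.unitaryGroup n ℂ :=
  Matrix.mem_unitaryGroup_iff'.2 (hΦ.star_mul_self_eq_one hV hK hherm ht)

lemma IsPropagator.norm_I_smul_matrixLog_le {V Φ : ℝ → Matrix n n ℂ} {T K : ℝ} (hT : 0 ≤ T)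
    (hΦ : IsPropagator V T Φ) (hV : AEStronglyMeasurable V (volume.restrict (Icc 0 T)))
    (hK : ∀ t ∈ Icc 0 T, ‖V t‖ ≤ K) (hherm : ∀ t ∈ Icc 0 T, (V t).IsHermitian) :
    ‖I • matrixLog (Φ T)‖ ≤ K * T := by
  have hunit (t : ℝ) (ht : t ∈ Icc 0 T) := hΦ.mem_unitaryGroup hV hK hherm ht
  have hlip : ∀ s ∈ Icc 0 T, ∀ t ∈ Icc 0 T, s ≤ t → ‖Φ t - Φ s‖ ≤ K * (t - s) := by
    intro s hs t ht hst
    simpa [abs_of_nonneg (sub_nonneg.2 hst)] using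
      hΦ.norm_sub_le hV hK (fun r hr => norm_le_one_of_mem_unitary (hunit r hr)) hs ht
  rw [norm_I_smul_matrixLog (hunit T (right_mem_Icc.2 hT)), ← hΦ.apply_zero hT]
  simpa using arcDist_le_mul_of_norm_sub_le hT hunit hlip

lemma isTimeOrderedExp_zero (V : ℝ → Matrix n n ℂ) : IsTimeOrderedExp V 0 1 :=
  ⟨fun _ => 1, continuousOn_const, fun t ht => by simp [le_antisymm ht.2 ht.1], rfl⟩

lemma isTimeOrderedExp_inv_smul_matrixLog (hU : U ∈ Matrix.unitaryGroup n ℂ) {T : ℝ}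
    (hT : T ≠ 0) : IsTimeOrderedExp (fun _ => (T : ℂ)⁻¹ • (I • matrixLog U)) T U := by
  refine isTimeOrderedExp_iff_exists_isPropagator.2 ⟨_, isPropagator_exp _ T, ?_⟩
  have hgen : (T : ℂ) • (-I • ((T : ℂ)⁻¹ • (I • matrixLog U))) = matrixLog U := by
    rw [smul_comm (-I), smul_inv_smul₀ (Complex.ofReal_ne_zero.2 hT), smul_smul]
    simp
  rw [hgen, exp_matrixLog (Unitary.coe_isStarNormal ⟨U, hU⟩) (Unitary.isUnit_coe (U := ⟨U, hU⟩))]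

lemma isChargingHamiltonian_const {V : Matrix n n ℂ} (hV : V.IsHermitian) (hnorm : ‖V‖ = 1)
    (T : ℝ) : IsChargingHamiltonian T fun _ => V :=
  ⟨aestronglyMeasurable_const, fun _ _ => hV, fun _ _ => hnorm⟩

lemma norm_I_smul_matrixLog_pos (hU : U ∈ Matrix.unitaryGroup n ℂ) (h : U ≠ 1) :
    0 < ‖I • matrixLog U‖ := by
  rw [norm_I_smul_matrixLog hU, arcDist]
  exact mul_pos two_pos (Real.arcsin_pos.2 (half_pos (norm_pos_iff.2 (sub_ne_zero.2 h))))

lemma charges_inv_norm_smul_matrixLog (hU : U ∈ connectingUnitaries ρ σ) (h : U ≠ 1) :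
    Charges ρ σ (fun _ => ((‖I • matrixLog U‖ : ℝ) : ℂ)⁻¹ • (I • matrixLog U))
      ‖I • matrixLog U‖ := by
  have hne := (norm_I_smul_matrixLog_pos hU.1 h).ne'
  refine ⟨norm_nonneg _, isChargingHamiltonian_const ?_ ?_ _, U,
    isTimeOrderedExp_inv_smul_matrixLog hU.1 hne, hU.2⟩
  · rw [← Complex.ofReal_inv, Complex.coe_smul]
    exact (isHermitian_I_smul_matrixLog hU.1).smul (IsSelfAdjoint.all _)
  · rw [norm_smul, norm_inv, Complex.norm_real, norm_norm, inv_mul_cancel₀ hne]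

lemma exists_charges_const [Nonempty n] (hU : U ∈ connectingUnitaries ρ σ) :
    ∃ V : Matrix n n ℂ, Charges ρ σ (fun _ => V) ‖I • matrixLog U‖ ∧
      IsTimeOrderedExp (fun _ => V) ‖I • matrixLog U‖ U := by
  by_cases h : U = 1
  · have hV : IsTimeOrderedExp (fun _ => 1) ‖I • matrixLog U‖ U := by
      rw [norm_I_smul_matrixLog hU.1, h, arcDist_self]
      exact isTimeOrderedExp_zero _
    exact ⟨1, ⟨norm_nonneg _, isChargingHamiltonian_const Matrix.isHermitian_one
      CStarRing.norm_one _, U, hV, hU.2⟩, hV⟩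
  · exact ⟨_, charges_inv_norm_smul_matrixLog hU h,
      isTimeOrderedExp_inv_smul_matrixLog hU.1 (norm_I_smul_matrixLog_pos hU.1 h).ne'⟩

lemma exists_mem_connectingUnitaries_norm_le {T : ℝ} (hT : T ∈ chargingTimes ρ σ) :
    ∃ U ∈ connectingUnitaries ρ σ, ‖I • matrixLog U‖ ≤ T := by
  obtain ⟨V, hT₀, hV, U, hVU, hU⟩ := hT
  obtain ⟨Φ, hΦ, rfl⟩ := isTimeOrderedExp_iff_exists_isPropagator.1 hVU
  have hnorm (t : ℝ) (ht : t ∈ Icc 0 T) : ‖V t‖ ≤ 1 := (hV.norm_eq_one t ht).le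
  refine ⟨Φ T, ⟨?_, hU⟩, ?_⟩
  · exact hΦ.mem_unitaryGroup hV.measurable hnorm hV.hermitian (right_mem_Icc.2 hT₀)
  · simpa using hΦ.norm_I_smul_matrixLog_le hT₀ hV.measurable hnorm hV.hermitian

end Charging

section Optimal

variable {n : Type*} [Fintype n]

lemma IsDensityMatrix.nonempty {ρ : Matrix n n ℂ} (hρ : IsDensityMatrix ρ) : Nonempty n := by
  by_contra h
  have := not_nonempty_iff.1 h
  simpa using hρ.2

variable [DecidableEq n] {ρ σ U : Matrix n n ℂ}

lemma connectingUnitaries_nonempty (hρ : ρ.IsHermitian) (hσ : σ.IsHermitian)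
    (hspec : SameSpectrum ρ σ) : (connectingUnitaries ρ σ).Nonempty := by
  have hchar : ρ.charpoly = σ.charpoly := by
    rw [hρ.splits_charpoly.eq_prod_roots_of_monic ρ.charpoly_monic,
      hσ.splits_charpoly.eq_prod_roots_of_monic σ.charpoly_monic, hspec]
  have heig := (Matrix.IsHermitian.eigenvalues_eq_eigenvalues_iff hρ hσ).2 hchar
  have hdiag := hσ.spectral_theorem
  rw [← heig] at hdiag
  refine ⟨(hσ.eigenvectorUnitary * star hρ.eigenvectorUnitary : Matrix.unitaryGroup n ℂ),
    Subtype.property _, ?_⟩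
  rw [← Matrix.star_eq_conjTranspose]
  change Unitary.conjStarAlgAut ℂ _ (hσ.eigenvectorUnitary * star hρ.eigenvectorUnitary) ρ = σ
  rw [Unitary.conjStarAlgAut_mul_apply, hρ.conjStarAlgAut_star_eigenvectorUnitary, ← hdiag]

lemma isCompact_connectingUnitaries (ρ σ : Matrix n n ℂ) :
    IsCompact (connectingUnitaries ρ σ) := by
  have : ProperSpace (Matrix n n ℂ) := FiniteDimensional.proper ℂ _
  refine (isCompact_closedBall (0 : Matrix n n ℂ) 1).of_isClosed_subset ?_ fun U hU => ?_
  · exact isClosed_unitary.inter (isClosed_eq (f := fun U => U * ρ * star U) (by fun_prop)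
      continuous_const)
  · simpa using norm_le_one_of_mem_unitary hU.1

lemma exists_isOptimalUnitary (h : (connectingUnitaries ρ σ).Nonempty) :
    ∃ U, IsOptimalUnitary ρ σ U := by
  have hcont : ContinuousOn (fun U : Matrix n n ℂ => ‖I • matrixLog U‖)
      (connectingUnitaries ρ σ) := by
    have harc : Continuous fun U : Matrix n n ℂ => arcDist U 1 := by
      unfold arcDist
      fun_prop
    exact harc.continuousOn.congr fun U hU => norm_I_smul_matrixLog hU.1
  obtain ⟨U, hU, hmin⟩ := (isCompact_connectingUnitaries ρ σ).exists_isMinOn h hcont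
  exact ⟨U, hU, fun W hW => hmin hW⟩

namespace IsOptimalUnitary

lemma ne_one (hU : IsOptimalUnitary ρ σ U) (h : ρ ≠ σ) : U ≠ 1 := by
  rintro rfl
  exact h (by simpa using hU.1.2)

lemma isLeast_image (hU : IsOptimalUnitary ρ σ U) :
    IsLeast ((fun U => ‖I • matrixLog U‖) '' connectingUnitaries ρ σ) ‖I • matrixLog U‖ :=
  ⟨mem_image_of_mem _ hU.1, forall_mem_image.2 hU.2⟩

lemma isLeast_chargingTimes [Nonempty n] (hU : IsOptimalUnitary ρ σ U) :
    IsLeast (chargingTimes ρ σ) ‖I • matrixLog U‖ := by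
  refine ⟨?_, fun T hT => ?_⟩
  · obtain ⟨V, hV, -⟩ := exists_charges_const hU.1
    exact ⟨_, hV⟩
  · obtain ⟨W, hW, hWT⟩ := exists_mem_connectingUnitaries_norm_le hT
    exact (hU.2 W hW).trans hWT

lemma chargingDistance_eq [Nonempty n] (hU : IsOptimalUnitary ρ σ U) :
    chargingDistance ρ σ = ‖I • matrixLog U‖ :=
  hU.isLeast_chargingTimes.csInf_eq

end IsOptimalUnitary

end Optimal

end QuantumCharging

open QuantumCharging in
theorem theorem2_general {n : Type*} [Fintype n] [DecidableEq n] [Nonempty n] (ρ σ : Matrix n n ℂ)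
    (h : (connectingUnitaries ρ σ).Nonempty) :
    IsLeast (chargingTimes ρ σ) (chargingDistance ρ σ) ∧
    (∃ V : Matrix n n ℂ, Charges ρ σ (fun _ => V) (chargingDistance ρ σ)) ∧
    IsLeast ((fun U => ‖Complex.I • matrixLog U‖) '' connectingUnitaries ρ σ)
      (chargingDistance ρ σ) ∧
    ∀ U : Matrix n n ℂ, IsOptimalUnitary ρ σ U →
      (∃ V : Matrix n n ℂ, Charges ρ σ (fun _ => V) (chargingDistance ρ σ) ∧
        IsTimeOrderedExp (fun _ => V) (chargingDistance ρ σ) U) ∧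
      (ρ ≠ σ →
        0 < chargingDistance ρ σ ∧
        Charges ρ σ
          (fun _ => ((chargingDistance ρ σ : ℝ) : ℂ)⁻¹ • (Complex.I • matrixLog U))
          (chargingDistance ρ σ) ∧
        IsTimeOrderedExp
          (fun _ => ((chargingDistance ρ σ : ℝ) : ℂ)⁻¹ • (Complex.I • matrixLog U))
          (chargingDistance ρ σ) U) := by
  obtain ⟨U₀, hU₀⟩ := exists_isOptimalUnitary h
  refine ⟨?_, ?_, ?_, fun U hU => ?_⟩
  · exact hU₀.chargingDistance_eq ▸ hU₀.isLeast_chargingTimes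
  · obtain ⟨V, hV, -⟩ := exists_charges_const hU₀.1
    exact ⟨V, hU₀.chargingDistance_eq ▸ hV⟩
  · exact hU₀.chargingDistance_eq ▸ hU₀.isLeast_image
  · rw [hU.chargingDistance_eq]
    refine ⟨exists_charges_const hU.1, fun hne => ?_⟩
    have hpos := norm_I_smul_matrixLog_pos hU.1.1 (hU.ne_one hne)
    exact ⟨hpos, charges_inv_norm_smul_matrixLog hU.1 (hU.ne_one hne),
      isTimeOrderedExp_inv_smul_matrixLog hU.1.1 hpos.ne'⟩

theorem theorem2 {n : Type*} [Fintype n] [DecidableEq n] (ρ σ : Matrix n n ℂ)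
    (hρ : QuantumCharging.IsDensityMatrix ρ) (hσ : QuantumCharging.IsDensityMatrix σ)
    (hspec : QuantumCharging.SameSpectrum ρ σ) :
    -- the minimal charging time exists
    IsLeast (QuantumCharging.chargingTimes ρ σ) (QuantumCharging.chargingDistance ρ σ) ∧
    -- it is attained by a time-independent Hamiltonian
    (∃ V : Matrix n n ℂ,
      QuantumCharging.Charges ρ σ (fun _ => V) (QuantumCharging.chargingDistance ρ σ)) ∧
    -- it equals the (attained) minimum of the norm of `i ln U`
    IsLeast ((fun U => ‖Complex.I • QuantumCharging.matrixLog U‖) ''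
        QuantumCharging.connectingUnitaries ρ σ)
      (QuantumCharging.chargingDistance ρ σ) ∧
    -- every optimal unitary is reached in the minimal time, by `i ln U / D` if the states differ
    ∀ U : Matrix n n ℂ, QuantumCharging.IsOptimalUnitary ρ σ U →
      (∃ V : Matrix n n ℂ,
        QuantumCharging.Charges ρ σ (fun _ => V) (QuantumCharging.chargingDistance ρ σ) ∧
        QuantumCharging.IsTimeOrderedExp (fun _ => V)
          (QuantumCharging.chargingDistance ρ σ) U) ∧
      (ρ ≠ σ →
        0 < QuantumCharging.chargingDistance ρ σ ∧
        QuantumCharging.Charges ρ σ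
          (fun _ => ((QuantumCharging.chargingDistance ρ σ : ℝ) : ℂ)⁻¹ •
            (Complex.I • QuantumCharging.matrixLog U))
          (QuantumCharging.chargingDistance ρ σ) ∧
        QuantumCharging.IsTimeOrderedExp
          (fun _ => ((QuantumCharging.chargingDistance ρ σ : ℝ) : ℂ)⁻¹ •
            (Complex.I • QuantumCharging.matrixLog U))
          (QuantumCharging.chargingDistance ρ σ) U) := by
  have := hρ.nonempty
  exact theorem2_general ρ σ
    (QuantumCharging.connectingUnitaries_nonempty hρ.1.isHermitian hσ.1.isHermitian hspec)
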